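/- Let $n\ge 0$, $\Omega=\{1,\dots,n\}$, let $\lambda=(\lambda_1\ge\lambda_2\ge\cdots)$ be a partition of $n$ with $\lambda\ne(n)$, and let $G\le S_n$ be a permutation group on $\Omega$ with $G\ne A_n,S_n$. An ordered partition of type $(l_1,\dots,l_r)$ of a finite set $S$ is a sequence $(A_1,\dots,A_r)$ of pairwise disjoint sets with union $S$ and $|A_i|=l_i$. A group $H$ acting on $S$ is $(l_1,\dots,l_r)$-transitive on $S$ if for any two ordered partitions $(A_i)$, $(B_i)$ of $S$ of this type some $g\in H$ satisfies $A_ig=B_i$ for all $i$. The group $G$ is $\lambda$-transitive if it is so on $\Omega$, and $t$-homogeneous if it is transitive on the $t$-element subsets of $\Omega$. The pair $(G,\lambda)$ is standard if there is an integer $t$ with $0\le t\le n/2$ such that $\lambda=(n-t,k_1,\dots,k_{r-1})$ (so the largest part of $\lambda$ is $n-t$), $G$ is $t$-homogeneous, and the setwise stabiliser in $G$ of any $t$-element subset $T$ of $\Omega$ acts $(k_1,\dots,k_{r-1})$-transitively on $T$. Then $G$ is $\lambda$-transitive if and only if $(G,\lambda)$ is standard. Moreover, if $n\ne 6$, then $G$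 is $\lambda$-transitive if and only if $(G,\lambda)$ is standard with $t<n/2$. -/

import Mathlib

open scoped Pointwise

/-- The sequence `A = (A₁, …, Aᵣ)` is an ordered partition of the finite set `S` of type
`l = (l₁, …, lᵣ)`: the `Aᵢ` are pairwise disjoint with union `S`, and `|Aᵢ| = lᵢ`. -/
def IsOrderedPartition {α : Type*} [DecidableEq α] (S : Finset α) (l : List ℕ)
    (A : Fin l.length → Finset α) : Prop :=
  (∀ i, (A i).card = l.get i) ∧
    (∀ i j, i ≠ j → Disjoint (A i) (A j)) ∧
      Finset.univ.biUnion A = S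

/-- `H` acts `l`-transitively on the finite set `S`: any two ordered partitions of `S` of type `l`
are mapped to each other, part by part, by an element of `H`.
(Used when `H` leaves `S` invariant.) -/
def IsPartitionTransitiveOn {α : Type*} [DecidableEq α] (H : Subgroup (Equiv.Perm α))
    (S : Finset α) (l : List ℕ) : Prop :=
  ∀ A B : Fin l.length → Finset α, IsOrderedPartition S l A → IsOrderedPartition S l B →
    ∃ g ∈ H, ∀ i, g • A i = B i

/-- The parts of a partition `lam` of `n`, listed in non-increasing order. -/
def Nat.Partition.sortedParts {n : ℕ} (lam : n.Partition) : List ℕ :=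
  lam.parts.sort (· ≥ ·)

/-- The permutation group `G` of degree `n` is `lam`-transitive. -/
def IsPartitionTransitive {n : ℕ} (G : Subgroup (Equiv.Perm (Fin n))) (lam : n.Partition) : Prop :=
  IsPartitionTransitiveOn G Finset.univ lam.sortedParts

/-- `G` is `t`-homogeneous: it is transitive on the `t`-element subsets of `{1, …, n}`. -/
def IsHomogeneousGroup {n : ℕ} (G : Subgroup (Equiv.Perm (Fin n))) (t : ℕ) : Prop :=
  ∀ S T : Finset (Fin n), S.card = t → T.card = t → ∃ g ∈ G, g • S = T

/-- The setwise stabiliser in `G` of the finite set `T`. -/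
def setStabilizer {n : ℕ} (G : Subgroup (Equiv.Perm (Fin n))) (T : Finset (Fin n)) :
    Subgroup (Equiv.Perm (Fin n)) :=
  G ⊓ MulAction.stabilizer (Equiv.Perm (Fin n)) T

/-- The three conditions of standardness of `(G, lam)` for a given `t`, apart from the bound
on `t`: `G` is `t`-homogeneous, `lam = (n - t, k₁, …, kᵣ₋₁)`, and the stabiliser in `G` of a
`t`-set acts `(k₁, …, kᵣ₋₁)`-transitively on it. -/
def IsStandardAt {n : ℕ} (G : Subgroup (Equiv.Perm (Fin n))) (lam : n.Partition) (t : ℕ) : Prop :=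
  IsHomogeneousGroup G t ∧
    ∃ k : List ℕ, lam.sortedParts = (n - t) :: k ∧
      ∀ T : Finset (Fin n), T.card = t → IsPartitionTransitiveOn (setStabilizer G T) T k

/-- The pair `(G, lam)` is standard; the bound on `t` is `t ≤ n / 2`. -/
def IsStandard {n : ℕ} (G : Subgroup (Equiv.Perm (Fin n))) (lam : n.Partition) : Prop :=
  ∃ t : ℕ, 2 * t ≤ n ∧ IsStandardAt G lam t

/-- The pair `(G, lam)` is standard with the strict bound `t < n / 2`. -/
def IsStrictlyStandard {n : ℕ} (G : Subgroup (Equiv.Perm (Fin n))) (lam : n.Partition) : Prop :=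
  ∃ t : ℕ, 2 * t < n ∧ IsStandardAt G lam t

/-!
If the largest part `a` of `λ` exceeds `n / 2`, then `λ`-transitivity is standardness with
`t = n - a`, as one sees by placing the largest part last. So suppose `a ≤ n / 2` and that `G` is
`λ`-transitive. A Young subgroup of type `λ` acts transitively on the cosets of `G`, so `[Sₙ : G]`
divides `∏ λᵢ!` and is prime to every prime `p > a`; as the `p`-cycles act on these cosets, some
`p`-cycle fixes one, and `G` contains a `p`-cycle. For `n ≥ 8` a strengthening of Bertrand's
postulate gives a prime `p` with `n / 2 < p ≤ n - 3`, and Jordan's theorem on cycles of prime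
length yields `Aₙ ≤ G`. For `n < 8` a `3`-cycle does the same, except when `n = 6` and `a = 3`,
and when `n = 7`. In degree `7` the group `G ∩ A₇` is `3`-transitive and contains an involution
fixing three points, so its index in `A₇` is at most `6`, which is too small for a proper subgroup
of a simple group of order `2520 > 6!`.
-/

theorem pow_factorization_centralBinom_le {n p : ℕ} (hn : 2 < n) (hp : p.Prime) :
    p ^ n.centralBinom.factorization p ≤
      (if p ≤ (2 * n).sqrt then 2 * n else 1) * (if p ≤ 2 * n / 3 then p else 1) *
        (if n < p then p else 1) := by
  have hp1 := hp.one_lt.le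
  rcases le_or_gt p (2 * n).sqrt with hps | hps
  · have hpow : p ^ n.centralBinom.factorization p ≤ 2 * n :=
      Nat.pow_factorization_choose_le (by lia)
    have hone (b : Prop) [Decidable b] : 1 ≤ if b then p else 1 := by split_ifs <;> lia
    rw [if_pos hps]
    exact (hpow.trans (Nat.le_mul_of_pos_right _ (hone _))).trans
      (Nat.le_mul_of_pos_right _ (hone _))
  have hpow : p ^ n.centralBinom.factorization p ≤ p :=
    (Nat.pow_le_pow_right hp1
      (Nat.factorization_choose_le_one (Nat.sqrt_lt'.mp hps))).trans_eq (pow_one p)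
  by_cases hmid : 2 * n / 3 < p ∧ p ≤ n
  · rw [Nat.factorization_centralBinom_of_two_mul_self_lt_three_mul hn hmid.2 (by lia), pow_zero]
    split_ifs <;> lia
  · split_ifs <;> lia

theorem centralBinom_le_mul_prod_primes {n : ℕ} (hn : 2 < n) :
    n.centralBinom ≤ (2 * n) ^ ((2 * n).sqrt - 1) * 4 ^ (2 * n / 3) *
      ∏ p ∈ Finset.Ioc n (2 * n) with p.Prime, p := by
  let P := {p ∈ Finset.range (2 * n + 1) | p.Prime}
  have hP {p : ℕ} (hp : p ∈ P) : p < 2 * n + 1 ∧ p.Prime := by simpa [P] using hp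
  have hsmall : ∏ p ∈ P, (if p ≤ (2 * n).sqrt then 2 * n else 1) ≤
      (2 * n) ^ ((2 * n).sqrt - 1) := by
    rw [← Finset.prod_filter, Finset.prod_const, ← Nat.card_Ioc]
    -- `1` is not prime; the factor `2 * n` saved here absorbs one prime of `(n, 2 * n]` below.
    refine Nat.pow_le_pow_right (by lia) (Finset.card_le_card fun p hp => ?_)
    obtain ⟨hp, hps⟩ := Finset.mem_filter.mp hp
    exact Finset.mem_Ioc.mpr ⟨(hP hp).2.one_lt, hps⟩
  have hmedium : ∏ p ∈ P, (if p ≤ 2 * n / 3 then p else 1) ≤ 4 ^ (2 * n / 3) := by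
    rw [← Finset.prod_filter]
    refine (Finset.prod_le_prod_of_subset_of_one_le' (fun p hp => ?_) fun p hp _ => ?_).trans
      (primorial_le_four_pow (2 * n / 3))
    · obtain ⟨hp, hpn⟩ := Finset.mem_filter.mp hp
      simpa [Nat.lt_succ_iff, hpn] using (hP hp).2
    · exact (Finset.mem_filter.mp hp).2.one_lt.le
  have hlarge : ∏ p ∈ P, (if n < p then p else 1) =
      ∏ p ∈ Finset.Ioc n (2 * n) with p.Prime, p := by
    rw [← Finset.prod_filter]
    congr 1
    ext p
    simp only [P, Finset.mem_filter, Finset.mem_range, Finset.mem_Ioc]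
    lia
  calc n.centralBinom
      = ∏ p ∈ P, p ^ n.centralBinom.factorization p := by
        rw [Finset.prod_filter_of_ne, Nat.prod_pow_factorization_centralBinom]
        intro p _ hne
        contrapose! hne
        rw [Nat.factorization_eq_zero_of_not_prime _ hne, pow_zero]
    _ ≤ _ := Finset.prod_le_prod' fun p hp => pow_factorization_centralBinom_le hn (hP hp).2
    _ = (∏ p ∈ P, if p ≤ (2 * n).sqrt then 2 * n else 1) *
          (∏ p ∈ P, if p ≤ 2 * n / 3 then p else 1) * ∏ p ∈ P, if n < p then p else 1 := by
        rw [Finset.prod_mul_distrib, Finset.prod_mul_distrib]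
    _ ≤ _ := by rw [hlarge]; gcongr

theorem one_lt_card_primes_Ioc {n : ℕ} (hn : 512 ≤ n) :
    1 < (Finset.filter Nat.Prime (Finset.Ioc n (2 * n))).card := by
  by_contra! hcard
  have hprod : ∏ p ∈ Finset.Ioc n (2 * n) with p.Prime, p ≤ 2 * n :=
    calc ∏ p ∈ Finset.Ioc n (2 * n) with p.Prime, p
        ≤ (2 * n) ^ (Finset.filter Nat.Prime (Finset.Ioc n (2 * n))).card :=
          Finset.prod_le_pow_card _ _ _ fun p hp =>
            (Finset.mem_Ioc.mp (Finset.mem_filter.mp hp).1).2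
      _ ≤ (2 * n) ^ 1 := Nat.pow_le_pow_right (by lia) hcard
      _ = 2 * n := pow_one _
  have hsqrt : (2 * n).sqrt - 1 + 1 = (2 * n).sqrt :=
    Nat.sub_add_cancel (Nat.sqrt_pos.mpr (by lia))
  refine (Nat.four_pow_lt_mul_centralBinom n (by lia)).not_ge ?_
  calc n * n.centralBinom
      ≤ n * ((2 * n) ^ ((2 * n).sqrt - 1) * 4 ^ (2 * n / 3) * (2 * n)) := by
        gcongr
        exact (centralBinom_le_mul_prod_primes (by lia)).trans (Nat.mul_le_mul_left _ hprod)
    _ = n * (2 * n) ^ ((2 * n).sqrt - 1 + 1) * 4 ^ (2 * n / 3) := by ring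
    _ = n * (2 * n) ^ (2 * n).sqrt * 4 ^ (2 * n / 3) := by rw [hsqrt]
    _ ≤ 4 ^ n := bertrand_main_inequality hn

theorem exists_prime_lt_two_mul_and_add_three_le {n : ℕ} (hn : 8 ≤ n) :
    ∃ p, p.Prime ∧ n < 2 * p ∧ p + 3 ≤ n := by
  rcases le_or_gt 1024 n with hlarge | hsmall
  · obtain ⟨p, hp, q, hq, hpq⟩ :=
      Finset.one_lt_card.mp (one_lt_card_primes_Ioc (n := n / 2) (by lia))
    wlog hlt : p < q generalizing p q
    · exact this q hq p hp hpq.symm (by lia)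
    simp only [Finset.mem_filter, Finset.mem_Ioc] at hp hq
    obtain ⟨i, hi⟩ := hp.2.odd_of_ne_two (by lia)
    obtain ⟨j, hj⟩ := hq.2.odd_of_ne_two (by lia)
    exact ⟨p, hp.2, by lia, by lia⟩
  have hcover : ∃ p ∈ [5, 7, 11, 19, 31, 59, 113, 223, 443, 883], n < 2 * p ∧ p + 3 ≤ n := by
    simp only [List.mem_cons, List.not_mem_nil, or_false, exists_eq_or_imp, exists_eq_left]
    omega
  obtain ⟨p, hmem, hnp, hpn⟩ := hcover
  refine ⟨p, ?_, hnp, hpn⟩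
  have hprime : ∀ p ∈ [5, 7, 11, 19, 31, 59, 113, 223, 443, 883], p.Prime := by norm_num
  exact hprime p hmem

section Group

open scoped commutatorElement

variable {Γ : Type*} [Group Γ]

theorem exists_conj_mem_of_not_dvd_index {Q : Subgroup Γ} {p : ℕ}
    (hp : p.Prime) (hQ : ¬ p ∣ Q.index) {x : Γ} (hx : orderOf x = p) :
    ∃ g : Γ, g * x * g⁻¹ ∈ Q := by
  have : Fact p.Prime := ⟨hp⟩
  have hpgroup : IsPGroup p (Subgroup.zpowers x) :=
    IsPGroup.of_card (n := 1) (by rw [Nat.card_zpowers, hx, pow_one])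
  obtain ⟨y, hy⟩ := hpgroup.nonempty_fixed_point_of_prime_not_dvd_card (Γ ⧸ Q) hQ
  obtain ⟨g, rfl⟩ := QuotientGroup.mk_surjective y
  have hfix : ((x * g : Γ) : Γ ⧸ Q) = (g : Γ ⧸ Q) := hy ⟨x, Subgroup.mem_zpowers x⟩
  rw [eq_comm, QuotientGroup.eq, ← mul_assoc] at hfix
  exact ⟨g⁻¹, by rwa [inv_inv]⟩

theorem eq_top_of_factorial_index_lt_card [Finite Γ] [IsSimpleGroup Γ]
    {K : Subgroup Γ} (h : K.index.factorial < Nat.card Γ) : K = ⊤ := by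
  rcases K.normalCore_normal.eq_bot_or_eq_top with hcore | hcore
  · rw [Subgroup.normalCore_eq_ker, MonoidHom.ker_eq_bot_iff] at hcore
    have hcard := Nat.card_le_card_of_injective _ hcore
    rw [Nat.card_perm, ← Subgroup.index_eq_card] at hcard
    exact absurd h hcard.not_gt
  · exact top_le_iff.mp (hcore ▸ K.normalCore_le)

theorem commute_commutatorElement_inv_inv_of_conj_mem_zpowers {u v c : Γ}
    (hu : u * c * u⁻¹ ∈ Subgroup.zpowers c) (hv : v * c * v⁻¹ ∈ Subgroup.zpowers c) :
    Commute ⁅u⁻¹, v⁻¹⁆ c := by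
  obtain ⟨i, hi : c ^ i = u * c * u⁻¹⟩ := hu
  obtain ⟨j, hj : c ^ j = v * c * v⁻¹⟩ := hv
  have hu : SemiconjBy u c (c ^ i) := by rw [hi, SemiconjBy, inv_mul_cancel_right]
  have hv : SemiconjBy v c (c ^ j) := by rw [hj, SemiconjBy, inv_mul_cancel_right]
  have huv : SemiconjBy (u * v) c (c ^ (i * j)) := by
    rw [zpow_mul]
    exact (hu.zpow_right j).mul_left hv
  have hvu : SemiconjBy (v * u) c (c ^ (i * j)) := by
    rw [mul_comm i j, zpow_mul]
    exact (hv.zpow_right i).mul_left hu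
  rw [commutatorElement_def, inv_inv, inv_inv, ← mul_inv_rev, mul_assoc]
  exact hvu.inv_symm_left.mul_left huv

theorem commutatorElement_mul_mul_of_commute {a b k l : Γ}
    (hak : Commute a k) (hal : Commute a l) (hbk : Commute b k) (hbl : Commute b l) :
    ⁅a * k, b * l⁆ = ⁅a, b⁆ * ⁅k, l⁆ := by
  have hab : Commute ⁅k, l⁆ (b * a)⁻¹ := by
    have hk : Commute k (b * a) := (hbk.mul_left hak).symm
    have hl : Commute l (b * a) := (hbl.mul_left hal).symm
    exact (((hk.mul_left hl).mul_left hk.inv_left).mul_left hl.inv_left).inv_right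
  calc ⁅a * k, b * l⁆ = a * k * (b * l) * (b * l * (a * k))⁻¹ := by group
    _ = a * b * (k * l) * (b * a * (l * k))⁻¹ := by
      rw [hbk.symm.mul_mul_mul_comm, hal.symm.mul_mul_mul_comm]
    _ = a * b * (⁅k, l⁆ * (b * a)⁻¹) := by group
    _ = ⁅a, b⁆ * ⁅k, l⁆ := by rw [hab.eq]; group

end Group

section OrderedPartition

variable {α : Type*} [DecidableEq α]

theorem isOrderedPartition_cons_iff {S : Finset α} {a : ℕ} {l : List ℕ}
    {A : Fin (a :: l).length → Finset α} :
    IsOrderedPartition S (a :: l) A ↔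
      A 0 ⊆ S ∧ (A 0).card = a ∧ IsOrderedPartition (S \ A 0) l (fun i => A i.succ) := by
  set U := Finset.univ.biUnion fun i : Fin l.length => A i.succ with hU
  have hunion : Finset.univ.biUnion A = A 0 ∪ U := by
    ext x
    simp [hU, Fin.exists_fin_succ]
  have hcard : (∀ i, (A i).card = (a :: l).get i) ↔
      (A 0).card = a ∧ ∀ i : Fin l.length, (A i.succ).card = l.get i := Fin.forall_fin_succ
  have hdisj : (∀ i j, i ≠ j → Disjoint (A i) (A j)) ↔
      Disjoint (A 0) U ∧ ∀ i j : Fin l.length, i ≠ j → Disjoint (A i.succ) (A j.succ) := by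
    rw [Finset.disjoint_biUnion_right]
    constructor
    · exact fun h => ⟨fun i _ => h _ _ (Fin.succ_ne_zero i).symm,
        fun i j hij => h _ _ ((Fin.succ_injective _).ne hij)⟩
    · rintro ⟨h0, hsucc⟩
      refine Fin.cases (Fin.cases (by simp) fun j _ => h0 j (Finset.mem_univ j)) fun i => ?_
      exact Fin.cases (fun _ => (h0 i (Finset.mem_univ i)).symm)
        fun j hij => hsucc i j (by simpa using hij)
  have hsdiff : Disjoint (A 0) U ∧ A 0 ∪ U = S ↔ A 0 ⊆ S ∧ U = S \ A 0 := by
    constructor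
    · rintro ⟨h, rfl⟩
      exact ⟨Finset.subset_union_left, (Finset.union_sdiff_cancel_left h).symm⟩
    · rintro ⟨h, hUS⟩
      rw [hUS]
      exact ⟨Finset.disjoint_sdiff, Finset.union_sdiff_of_subset h⟩
  rw [IsOrderedPartition, IsOrderedPartition, hunion, hcard, hdisj]
  tauto

theorem exists_isOrderedPartition (l : List ℕ) (S : Finset α) (h : l.sum = S.card) :
    ∃ A, IsOrderedPartition S l A := by
  induction l generalizing S with
  | nil =>
    have hS : S = ∅ := by simpa using h.symm
    exact ⟨fun _ => ∅, fun i => i.elim0, fun i => i.elim0, by simp [hS]⟩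
  | cons a l ih =>
    rw [List.sum_cons] at h
    obtain ⟨T, hTS, hT⟩ := Finset.exists_subset_card_eq (s := S) (n := a) (by lia)
    obtain ⟨A, hA⟩ := ih (S \ T) (by rw [Finset.card_sdiff_of_subset hTS]; lia)
    exact ⟨Fin.cons T A, isOrderedPartition_cons_iff.mpr ⟨hTS, hT, hA⟩⟩

theorem IsOrderedPartition.smul {S : Finset α} {l : List ℕ} {A : Fin l.length → Finset α}
    (hA : IsOrderedPartition S l A) {Γ : Type*} [Group Γ] [MulAction Γ α] (g : Γ) :
    IsOrderedPartition (g • S) l (fun i => g • A i) := by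
  obtain ⟨hcard, hdisj, hunion⟩ := hA
  refine ⟨fun i => by rw [Finset.card_smul_finset, hcard], fun i j hij => ?_, ?_⟩
  · exact (Finset.disjoint_image (MulAction.injective g)).mpr (hdisj i j hij)
  · ext x
    simp [← hunion, ← Finset.inv_smul_mem_iff]

theorem smul_finset_compl {Γ : Type*} [Group Γ] [MulAction Γ α] [Fintype α] (g : Γ)
    (S : Finset α) : g • Sᶜ = (g • S)ᶜ := by
  rw [Finset.compl_eq_univ_sdiff, Finset.compl_eq_univ_sdiff, Finset.smul_finset_sdiff,
    Finset.smul_finset_univ]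

theorem isPartitionTransitiveOn_univ_cons_iff [Fintype α] {G : Subgroup (Equiv.Perm α)} {a : ℕ}
    {k : List ℕ} :
    IsPartitionTransitiveOn G Finset.univ (a :: k) ↔
      ∀ (S T : Finset α) (A B : Fin k.length → Finset α), Sᶜ.card = a → Tᶜ.card = a →
        IsOrderedPartition S k A → IsOrderedPartition T k B →
          ∃ g ∈ G, g • S = T ∧ ∀ i, g • A i = B i := by
  constructor
  · intro h S T A B hS hT hA hB
    obtain ⟨g, hg, hgA⟩ := h (Fin.cons Sᶜ A) (Fin.cons Tᶜ B)
      (isOrderedPartition_cons_iff.mpr ⟨Finset.subset_univ _, hS, by simpa using hA⟩)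
      (isOrderedPartition_cons_iff.mpr ⟨Finset.subset_univ _, hT, by simpa using hB⟩)
    have hST : g • Sᶜ = Tᶜ := hgA 0
    rw [smul_finset_compl, compl_inj_iff] at hST
    exact ⟨g, hg, hST, fun i => hgA i.succ⟩
  · intro h A B hA hB
    obtain ⟨-, hA0, hA⟩ := isOrderedPartition_cons_iff.mp hA
    obtain ⟨-, hB0, hB⟩ := isOrderedPartition_cons_iff.mp hB
    rw [← Finset.compl_eq_univ_sdiff] at hA hB
    obtain ⟨g, hg, hg0, hgA⟩ := h _ _ _ _ (by rwa [compl_compl]) (by rwa [compl_compl]) hA hB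
    rw [smul_finset_compl, compl_inj_iff] at hg0
    exact ⟨g, hg, Fin.cases hg0 hgA⟩

end OrderedPartition

section Standard

variable {n : ℕ} {G : Subgroup (Equiv.Perm (Fin n))} {lam : n.Partition}

theorem sum_sortedParts (lam : n.Partition) : lam.sortedParts.sum = n := by
  rw [← Multiset.sum_coe, Nat.Partition.sortedParts, Multiset.sort_eq, lam.parts_sum]

theorem exists_sortedParts_eq_cons (hn : n ≠ 0) (lam : n.Partition) :
    ∃ a k, lam.sortedParts = a :: k ∧ 0 < a ∧ ∀ b ∈ k, b ≤ a := by
  have hsorted : lam.sortedParts.Pairwise (· ≥ ·) := Multiset.pairwise_sort _ _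
  rcases hl : lam.sortedParts with _ | ⟨a, k⟩
  · exact absurd (sum_sortedParts lam).symm (by simpa [hl] using hn)
  · rw [hl, List.pairwise_cons] at hsorted
    refine ⟨a, k, rfl, lam.parts_pos ?_, hsorted.1⟩
    rw [← Multiset.mem_sort (· ≥ ·), ← Nat.Partition.sortedParts]
    exact hl.symm ▸ List.mem_cons_self

theorem isPartitionTransitive_iff_isStandardAt {a : ℕ} {k : List ℕ}
    (hlam : lam.sortedParts = a :: k) :
    IsPartitionTransitive G lam ↔ IsStandardAt G lam (n - a) := by
  have hsum : a + k.sum = n := by rw [← List.sum_cons, ← hlam, sum_sortedParts]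
  have hcard {S : Finset (Fin n)} : Sᶜ.card = a ↔ S.card = n - a := by
    have := S.card_le_univ
    rw [Finset.card_compl]
    rw [Fintype.card_fin] at *
    lia
  rw [IsPartitionTransitive, hlam, isPartitionTransitiveOn_univ_cons_iff]
  simp only [hcard]
  constructor
  · intro h
    refine ⟨fun S T hS hT => ?_, k, by rw [hlam]; congr 1; lia, fun T hT A B hA hB => ?_⟩
    · obtain ⟨A, hA⟩ := exists_isOrderedPartition k S (by lia)
      obtain ⟨B, hB⟩ := exists_isOrderedPartition k T (by lia)
      obtain ⟨g, hg, hgS, -⟩ := h S T A B hS hT hA hB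
      exact ⟨g, hg, hgS⟩
    · obtain ⟨g, hg, hgT, hgA⟩ := h T T A B hT hT hA hB
      exact ⟨g, ⟨hg, hgT⟩, hgA⟩
  · rintro ⟨hhom, k', hk', hstab⟩ S T A B hS hT hA hB
    obtain rfl : k = k' := (List.cons.inj (hlam.symm.trans hk')).2
    obtain ⟨g, hg, rfl⟩ := hhom S T hS hT
    obtain ⟨g', ⟨hg', hfix⟩, hg'A⟩ := hstab _ hT _ _ (hA.smul g) hB
    refine ⟨g' * g, mul_mem hg' hg, ?_, fun i => ?_⟩
    · rw [mul_smul]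
      exact hfix
    · rw [mul_smul]
      exact hg'A i

theorem IsStandardAt.isPartitionTransitive {t : ℕ} (h : IsStandardAt G lam t) (ht : t ≤ n) :
    IsPartitionTransitive G lam := by
  obtain ⟨-, k, hk, -⟩ := id h
  rwa [isPartitionTransitive_iff_isStandardAt hk, Nat.sub_sub_self ht]

end Standard

section Index

variable {α : Type*} [DecidableEq α] [Fintype α] {G : Subgroup (Equiv.Perm α)} {l : List ℕ}

theorem IsOrderedPartition.card_iInf_stabilizer {A : Fin l.length → Finset α}
    (hA : IsOrderedPartition Finset.univ l A) :
    Nat.card (⨅ i, MulAction.stabilizer (Equiv.Perm α) (A i) : Subgroup (Equiv.Perm α)) =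
      (l.map Nat.factorial).prod := by
  obtain ⟨hcard, hdisj, hunion⟩ := hA
  have hcover (x : α) : ∃ i, x ∈ A i := by
    simpa using hunion.symm.subset (Finset.mem_univ x)
  choose f hf using hcover
  have hmem {i : Fin l.length} {x : α} : x ∈ A i ↔ f x = i :=
    ⟨fun hx => by_contra fun hne => Finset.disjoint_left.mp (hdisj _ _ hne) (hf x) hx,
      fun h => h ▸ hf x⟩
  have hfix (g : Equiv.Perm α) :
      g ∈ ⨅ i, MulAction.stabilizer (Equiv.Perm α) (A i) ↔ f ∘ g = f := by
    simp only [Subgroup.mem_iInf, MulAction.mem_stabilizer_iff]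
    constructor
    · intro h
      funext x
      rw [Function.comp_apply, ← hmem, ← h (f x)]
      exact Finset.smul_mem_smul_finset (hf x)
    · intro h i
      refine Finset.eq_of_subset_of_card_le (fun y hy => ?_) (Finset.card_smul_finset _ _).ge
      obtain ⟨x, hx, rfl⟩ := Finset.mem_smul_finset.mp hy
      exact hmem.mpr ((congrFun h x).trans (hmem.mp hx))
  calc Nat.card (⨅ i, MulAction.stabilizer (Equiv.Perm α) (A i) : Subgroup (Equiv.Perm α))
      = Fintype.card {g : Equiv.Perm α // f ∘ g = f} := by
        rw [← Nat.card_eq_fintype_card]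
        exact Nat.card_congr (Equiv.subtypeEquivRight hfix)
    _ = ∏ i, (Fintype.card {x // f x = i}).factorial := DomMulAct.stabilizer_card f
    _ = ∏ i, (l.get i).factorial := by
        refine Finset.prod_congr rfl fun i _ => ?_
        rw [← hcard i, Fintype.card_subtype]
        simp only [← hmem, Finset.filter_mem_eq_inter, Finset.univ_inter]
    _ = (l.map Nat.factorial).prod := by simp

theorem IsPartitionTransitiveOn.index_dvd (h : IsPartitionTransitiveOn G Finset.univ l)
    (hl : l.sum = Fintype.card α) : G.index ∣ (l.map Nat.factorial).prod := by
  obtain ⟨A, hA⟩ := exists_isOrderedPartition l (Finset.univ : Finset α) hl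
  let Y : Subgroup (Equiv.Perm α) := ⨅ i, MulAction.stabilizer (Equiv.Perm α) (A i)
  have htrans : MulAction.IsPretransitive Y (Equiv.Perm α ⧸ G) := by
    refine (MulAction.isPretransitive_iff_base (QuotientGroup.mk 1)).mpr fun x => ?_
    obtain ⟨s, rfl⟩ := QuotientGroup.mk_surjective x
    have hsA := hA.smul s⁻¹
    rw [Finset.smul_finset_univ] at hsA
    obtain ⟨g, hg, hgA⟩ := h A _ hA hsA
    have hsg : s * g ∈ Y := by
      simp only [Y, Subgroup.mem_iInf, MulAction.mem_stabilizer_iff]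
      exact fun i => by rw [mul_smul, hgA, smul_inv_smul]
    refine ⟨⟨s * g, hsg⟩, ?_⟩
    change ((s * g * 1 : Equiv.Perm α) : Equiv.Perm α ⧸ G) = s
    rw [QuotientGroup.eq]
    simpa using hg
  rw [← hA.card_iInf_stabilizer, Subgroup.index_eq_card,
    ← MulAction.index_stabilizer_of_transitive Y (QuotientGroup.mk 1 : Equiv.Perm α ⧸ G)]
  exact Subgroup.index_dvd_card _

theorem exists_isCycle_mem_of_not_dvd_index {p : ℕ} (hp : p.Prime) (hpα : p ≤ Fintype.card α)
    (hG : ¬ p ∣ G.index) : ∃ c ∈ G, c.IsCycle ∧ c.support.card = p := by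
  obtain ⟨c, hc⟩ := (Equiv.Perm.exists_with_cycleType_iff α (m := {p})).mpr
    ⟨by simpa using hpα, by simpa using hp.two_le⟩
  have hcycle : c.IsCycle := Equiv.Perm.card_cycleType_eq_one.mp (by rw [hc]; simp)
  have hcard : c.support.card = p := by rw [← Equiv.Perm.sum_cycleType, hc]; simp
  obtain ⟨g, hg⟩ := exists_conj_mem_of_not_dvd_index hp hG (hcycle.orderOf.trans hcard)
  exact ⟨_, hg, hcycle.conj, Equiv.Perm.card_support_conj.trans hcard⟩

theorem IsPartitionTransitiveOn.exists_isCycle_mem (h : IsPartitionTransitiveOn G Finset.univ l)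
    (hl : l.sum = Fintype.card α) {p : ℕ} (hp : p.Prime) (hlp : ∀ b ∈ l, b < p)
    (hpα : p ≤ Fintype.card α) : ∃ c ∈ G, c.IsCycle ∧ c.support.card = p := by
  refine exists_isCycle_mem_of_not_dvd_index hp hpα fun hdvd => ?_
  obtain ⟨m, hm, hpm⟩ := hp.prime.dvd_prod_iff.mp (hdvd.trans (h.index_dvd hl))
  obtain ⟨b, hb, rfl⟩ := List.mem_map.mp hm
  exact (hlp b hb).not_ge (hp.dvd_factorial.mp hpm)

end Index

theorem IsHomogeneousGroup.isPretransitive {n : ℕ} {G : Subgroup (Equiv.Perm (Fin n))} {t : ℕ}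
    (h : IsHomogeneousGroup G t) (ht : 0 < t) (htn : t < n) :
    MulAction.IsPretransitive G (Fin n) := by
  classical
  refine ⟨fun u v => ?_⟩
  by_contra hv
  change v ∉ MulAction.orbit G u at hv
  have huv : u ≠ v := fun huv => hv (huv ▸ MulAction.mem_orbit_self u)
  obtain ⟨S, huS, hSv, hS⟩ := Finset.exists_subsuperset_card_eq (s := {u}) (t := {v}ᶜ) (n := t)
    (by simpa using huv.symm) (by rwa [Finset.card_singleton])
    (by rw [Finset.card_compl, Fintype.card_fin, Finset.card_singleton]; lia)
  rw [Finset.singleton_subset_iff] at huS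
  rw [Finset.subset_compl_singleton] at hSv
  have hT : (insert v (S.erase u)).card = t := by
    rw [Finset.card_insert_of_notMem (fun h => hSv (Finset.mem_of_mem_erase h)),
      Finset.card_erase_add_one huS, hS]
  obtain ⟨g, hg, hgS⟩ := h S _ hS hT
  have hcard : {x ∈ g • S | x ∈ MulAction.orbit G u}.card =
      {x ∈ S | x ∈ MulAction.orbit G u}.card := by
    have horbit (x : Fin n) : g • x ∈ MulAction.orbit G u ↔ x ∈ MulAction.orbit G u := by
      rw [← MulAction.orbit_eq_iff, ← MulAction.orbit_eq_iff]
      exact (MulAction.orbit_smul (⟨g, hg⟩ : G) x).congr_left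
    rw [← Finset.image_smul, Finset.filter_image,
      Finset.card_image_of_injective _ (MulAction.injective g)]
    simp only [horbit]
  rw [hgS, Finset.filter_insert, if_neg hv, Finset.filter_erase] at hcard
  exact (Finset.card_erase_lt_of_mem
    (Finset.mem_filter.mpr ⟨huS, MulAction.mem_orbit_self u⟩)).ne hcard

section MultiplyPretransitive

open MulAction

variable {Γ α : Type*} [Group Γ] [MulAction Γ α]

theorem exists_forall_mem_smul_eq {s : Finset α} (h : IsMultiplyPretransitive Γ α s.card)
    (f : α ↪ α) : ∃ g : Γ, ∀ a ∈ s, g • a = f a := by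
  let e : Fin s.card ↪ α := s.equivFin.symm.toEmbedding.trans (Function.Embedding.subtype _)
  obtain ⟨g, hg⟩ := exists_smul_eq Γ e (e.trans f)
  refine ⟨g, fun a ha => ?_⟩
  simpa [e] using DFunLike.congr_fun hg (s.equivFin ⟨a, ha⟩)

variable [Fintype α] {m : ℕ}

theorem card_stabilizer_mul_descFactorial (h : IsMultiplyPretransitive Γ α m) (e : Fin m ↪ α) :
    Nat.card (stabilizer Γ e) * (Fintype.card α).descFactorial m = Nat.card Γ := by
  classical
  have : IsPretransitive Γ (Fin m ↪ α) := h
  rw [← (stabilizer Γ e).card_mul_index, index_stabilizer_of_transitive Γ e,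
    Nat.card_eq_fintype_card (α := Fin m ↪ α), Fintype.card_embedding_eq, Fintype.card_fin]

theorem two_mul_descFactorial_le_card [Finite Γ] (h : IsMultiplyPretransitive Γ α m) {x : Γ}
    (hx : x ≠ 1) (e : Fin m ↪ α) (hxe : ∀ i, x • e i = e i) :
    2 * (Fintype.card α).descFactorial m ≤ Nat.card Γ := by
  rw [← card_stabilizer_mul_descFactorial h e]
  refine Nat.mul_le_mul_right _ ((Subgroup.one_lt_card_iff_ne_bot _).mpr fun hbot => hx ?_)
  exact (Subgroup.eq_bot_iff_forall _).mp hbot x (DFunLike.ext _ _ hxe)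

end MultiplyPretransitive

section Cycle

open Equiv Equiv.Perm MulAction
open scoped commutatorElement

variable {α : Type*}

theorem card_fixingSubgroup_compl (s : Finset α) :
    Nat.card (fixingSubgroup (Perm α) ((s : Set α)ᶜ)) = s.card.factorial := by
  classical
  have e : fixingSubgroup (Perm α) ((s : Set α)ᶜ) ≃ {f : Perm α // ∀ a, ¬ a ∈ s → f a = a} :=
    Equiv.subtypeEquivRight fun f => by simp [mem_fixingSubgroup_iff]
  rw [Nat.card_congr (e.trans (Perm.subtypeEquivSubtypePerm (· ∈ s)).symm), Nat.card_perm,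
    Nat.card_eq_fintype_card, Fintype.card_coe]

variable [DecidableEq α] [Fintype α] {G : Subgroup (Perm α)} {c : Perm α}

theorem isPretransitive_of_isCycle_mem_of_support_eq_univ (hc : c.IsCycle)
    (hcG : c ∈ G) (huniv : c.support = Finset.univ) : IsPretransitive G α := by
  have hmoved (x : α) : c x ≠ x := mem_support.mp (huniv ▸ Finset.mem_univ x)
  refine ⟨fun x y => ?_⟩
  obtain ⟨i, hi⟩ := hc.sameCycle (hmoved x) (hmoved y)
  exact ⟨⟨c ^ i, zpow_mem hcG i⟩, hi⟩

theorem mem_fixingSubgroup_compl_iff {s : Finset α} {f : Perm α} :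
    f ∈ fixingSubgroup (Perm α) ((s : Set α)ᶜ) ↔ f.support ⊆ s := by
  rw [mem_fixingSubgroup_iff, ← Finset.compl_subset_compl]
  exact forall_congr' fun a => by simp

theorem isPreprimitive_ofFixingSubgroup_of_isCycle_mem (hc : c.IsCycle)
    (hp : c.support.card.Prime) (hcG : c ∈ G) :
    IsPreprimitive (fixingSubgroup G ((c.support : Set α)ᶜ))
      (SubMulAction.ofFixingSubgroup G ((c.support : Set α)ᶜ)) := by
  have := isPretransitive_of_isCycle_mem hc hcG
  refine IsPreprimitive.of_prime_card ?_
  have hcard : Nat.card (SubMulAction.ofFixingSubgroup G ((c.support : Set α)ᶜ)) =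
      c.support.card := by
    rw [← Set.ncard_coe_finset, ← Nat.card_coe_set_eq]
    exact Nat.card_congr (Equiv.subtypeEquivRight fun x => by
      simp [SubMulAction.mem_ofFixingSubgroup_iff])
  rwa [hcard]

theorem isPreprimitive_of_isCycle_mem [IsPretransitive G α] (hc : c.IsCycle)
    (hp : c.support.card.Prime) (hcG : c ∈ G) (hlt : Fintype.card α < 2 * c.support.card) :
    IsPreprimitive G α := by
  have := isPreprimitive_ofFixingSubgroup_of_isCycle_mem hc hp hcG
  let f : SubMulAction.ofFixingSubgroup G ((c.support : Set α)ᶜ)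
      →ₑ[(fixingSubgroup G ((c.support : Set α)ᶜ)).subtype] α :=
    ⟨Subtype.val, fun _ _ => rfl⟩
  have hrange : Set.range f = (c.support : Set α) := by
    change Set.range Subtype.val = _
    ext x
    simp [SubMulAction.mem_ofFixingSubgroup_iff]
  refine IsPreprimitive.of_card_lt (f := f) ?_
  rwa [hrange, Set.ncard_coe_finset, Nat.card_eq_fintype_card]

theorem isMultiplyPretransitive_of_isCycle_mem (hG : IsPreprimitive G α) (hc : c.IsCycle)
    (hp : c.support.card.Prime) (hcG : c ∈ G) (hlt : c.support.card < Fintype.card α) :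
    IsMultiplyPretransitive G α (Fintype.card α - c.support.card + 1) := by
  obtain ⟨m, hm⟩ := Nat.exists_eq_add_of_lt hlt
  have hncard : Set.ncard ((c.support : Set α)ᶜ) = m + 1 := by
    rw [← Finset.coe_compl, Set.ncard_coe_finset, Finset.card_compl]
    lia
  have hmult := hG.isMultiplyPreprimitive hncard
    (by rw [Nat.card_eq_fintype_card]; have := hp.two_le; lia)
    (isPreprimitive_ofFixingSubgroup_of_isCycle_mem hc hp hcG)
  rw [show Fintype.card α - c.support.card + 1 = m + 2 by lia]
  exact IsMultiplyPreprimitive.isMultiplyPretransitive ..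

theorem exists_conj_mem_zpowers_of_support_subset (hc : c.IsCycle) (hp : c.support.card.Prime)
    (hcG : c ∈ G) {d : Perm α} (hdG : d ∈ G) (hd : orderOf d = c.support.card)
    (hdc : d.support ⊆ c.support) :
    ∃ h ∈ G, h.support ⊆ c.support ∧ h * d * h⁻¹ ∈ Subgroup.zpowers c := by
  let H : Subgroup (Perm α) := G ⊓ fixingSubgroup (Perm α) ((c.support : Set α)ᶜ)
  have hmemH {f : Perm α} : f ∈ H ↔ f ∈ G ∧ f.support ⊆ c.support := by
    rw [Subgroup.mem_inf, mem_fixingSubgroup_compl_iff]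
  have hcH : c ∈ H := hmemH.mpr ⟨hcG, subset_rfl⟩
  let Q : Subgroup H := Subgroup.zpowers ⟨c, hcH⟩
  have hQ : ¬ c.support.card ∣ Q.index := by
    have hH : Nat.card H ∣ c.support.card.factorial := by
      rw [← card_fixingSubgroup_compl]
      exact Subgroup.card_dvd_of_le inf_le_right
    rw [← Q.card_mul_index, Nat.card_zpowers, Subgroup.orderOf_mk, hc.orderOf,
      ← Nat.mul_factorial_pred hp.ne_zero] at hH
    intro hdvd
    exact (Nat.sub_one_lt hp.ne_zero).not_ge
      (hp.dvd_factorial.mp (hdvd.trans (Nat.dvd_of_mul_dvd_mul_left hp.pos hH)))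
  obtain ⟨h, i, hi⟩ := exists_conj_mem_of_not_dvd_index hp hQ
    (x := ⟨d, hmemH.mpr ⟨hdG, hdc⟩⟩) (by rwa [Subgroup.orderOf_mk])
  obtain ⟨hhG, hhc⟩ := hmemH.mp h.2
  exact ⟨h, hhG, hhc, i, congrArg Subtype.val hi⟩

theorem exists_mul_mem_of_disjoint (hc : c.IsCycle) (hp : c.support.card.Prime) (hcG : c ∈ G)
    (hG : IsMultiplyPretransitive G α c.supportᶜ.card) {σ : Perm α} (hσ : σ.Disjoint c) :
    ∃ k : Perm α, k.support ⊆ c.support ∧ k * c * k⁻¹ ∈ Subgroup.zpowers c ∧ σ * k ∈ G := by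
  obtain ⟨⟨g, hg⟩, hgσ⟩ := exists_forall_mem_smul_eq hG σ.toEmbedding
  obtain ⟨k, rfl⟩ : ∃ k, g = σ * k := ⟨σ⁻¹ * g, by group⟩
  have hk : k.support ⊆ c.support := by
    rw [← Finset.compl_subset_compl]
    intro a ha
    rw [Finset.mem_compl, notMem_support]
    exact σ.injective (hgσ a ha)
  have hd : (k * c * k⁻¹).support ⊆ c.support := by
    rw [← mem_fixingSubgroup_compl_iff] at hk ⊢
    exact mul_mem (mul_mem hk (mem_fixingSubgroup_compl_iff.mpr subset_rfl)) (inv_mem hk)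
  have hcomm {f : Perm α} (hf : f.support ⊆ c.support) : Commute σ f :=
    (hσ.mono subset_rfl hf).commute
  have hdG : k * c * k⁻¹ ∈ G := by
    have hconj : σ * k * c * (σ * k)⁻¹ = k * c * k⁻¹ := by
      rw [mul_inv_rev, mul_assoc σ, mul_assoc σ, ← mul_assoc (k * c), ← mul_assoc,
        (hcomm hd).eq, mul_inv_cancel_right]
    exact hconj ▸ mul_mem (mul_mem hg hcG) (inv_mem hg)
  obtain ⟨h, hh, hhc, hhd⟩ := exists_conj_mem_zpowers_of_support_subset hc hp hcG hdG
    ((SemiconjBy.orderOf_eq k (x := c) (by simp [SemiconjBy])).symm.trans hc.orderOf) hd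
  refine ⟨h * k, ?_, by convert hhd using 1; group, ?_⟩
  · rw [← mem_fixingSubgroup_compl_iff] at hk hhc ⊢
    exact mul_mem hhc hk
  · rw [← mul_assoc, (hcomm hhc).eq, mul_assoc]
    exact mul_mem hh hg

theorem mem_zpowers_of_commute_of_support_subset (hc : c.IsCycle) {w : Perm α}
    (hwc : Commute w c) (hw : w.support ⊆ c.support) : w ∈ Subgroup.zpowers c := by
  obtain ⟨hmem, hzpowers⟩ := hc.commute_iff.mp hwc
  rwa [ofSubtype_subtypePerm] at hzpowers
  exact fun x hx => hw (mem_support.mpr hx)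

theorem commutatorElement_mem_of_disjoint (hc : c.IsCycle) (hp : c.support.card.Prime)
    (hcG : c ∈ G) (hG : IsMultiplyPretransitive G α c.supportᶜ.card) {σ τ : Perm α}
    (hσ : σ.Disjoint c) (hτ : τ.Disjoint c) : ⁅σ, τ⁆ ∈ G := by
  obtain ⟨k, hk, hkc, hkG⟩ := exists_mul_mem_of_disjoint hc hp hcG hG hσ.inv_left
  obtain ⟨l, hl, hlc, hlG⟩ := exists_mul_mem_of_disjoint hc hp hcG hG hτ.inv_left
  have hkl : ⁅k⁻¹, l⁻¹⁆ ∈ Subgroup.zpowers c := by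
    refine mem_zpowers_of_commute_of_support_subset hc
      (commute_commutatorElement_inv_inv_of_conj_mem_zpowers hkc hlc) ?_
    rw [← mem_fixingSubgroup_compl_iff] at hk hl ⊢
    exact mul_mem (mul_mem (mul_mem (inv_mem hk) (inv_mem hl)) (inv_mem (inv_mem hk)))
      (inv_mem (inv_mem hl))
  have hcomm {ρ f : Perm α} (hρ : ρ.Disjoint c) (hf : f.support ⊆ c.support) : Commute ρ f⁻¹ :=
    (hρ.mono subset_rfl hf).commute.inv_right
  have hσG : σ * k⁻¹ ∈ G := by
    rw [(hcomm hσ hk).eq]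
    simpa using inv_mem hkG
  have hτG : τ * l⁻¹ ∈ G := by
    rw [(hcomm hτ hl).eq]
    simpa using inv_mem hlG
  rw [← mul_mem_cancel_right (Subgroup.zpowers_le.mpr hcG hkl),
    ← commutatorElement_mul_mul_of_commute (hcomm hσ hk) (hcomm hσ hl) (hcomm hτ hk) (hcomm hτ hl)]
  exact mul_mem (mul_mem (mul_mem hσG hτG) (inv_mem hσG)) (inv_mem hτG)

/-- **Jordan's theorem** on cycles of prime length. Since `G` is `(n - p)`-transitive, every `σ`
disjoint from `c` becomes an element `σ * k` of `G` for some `k` moving only the support of `c`, and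
by Sylow's theorem `k` can be chosen to normalise `⟨c⟩`. The commutator of two such factors `k`
commutes with `c`, so lies in `⟨c⟩ ≤ G`; hence `G` contains all commutators `⁅σ, τ⁆`. -/
theorem alternatingGroup_le_of_isPreprimitive_of_isCycle_mem (hG : IsPreprimitive G α)
    (hc : c.IsCycle) (hp : c.support.card.Prime) (hcG : c ∈ G)
    (hcard : c.support.card + 3 ≤ Fintype.card α) : alternatingGroup α ≤ G := by
  have hcompl : 2 < c.supportᶜ.card := by
    rw [Finset.card_compl]
    lia
  have hmult : IsMultiplyPretransitive G α c.supportᶜ.card := by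
    have := isMultiplyPretransitive_of_isCycle_mem hG hc hp hcG (by lia)
    rw [Finset.card_compl]
    exact isMultiplyPretransitive_of_le (Nat.le_succ _)
      (by rw [Nat.card_eq_fintype_card]; have := hp.two_le; lia)
  obtain ⟨x, hx, y, hy, z, hz, hxy, hxz, hyz⟩ := Finset.two_lt_card.mp hcompl
  have hswap {a b : α} (hab : a ≠ b) (ha : a ∈ c.supportᶜ) (hb : b ∈ c.supportᶜ) :
      (swap a b).Disjoint c := by
    rw [disjoint_iff_disjoint_support, support_swap hab, ← Finset.subset_compl_iff_disjoint_right]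
    exact Finset.insert_subset ha (Finset.singleton_subset_iff.mpr hb)
  have hmem := commutatorElement_mem_of_disjoint hc hp hcG hmult (hswap hxy hx hy)
    (hswap hxz hx hz)
  have hthree : ⁅swap x y, swap x z⁆.IsThreeCycle := by
    rw [commutatorElement_def, swap_inv, swap_inv, mul_assoc, ← sq]
    exact (isThreeCycle_swap_mul_swap_same hxy hxz hyz).isThreeCycle_sq
  exact alternatingGroup_le_of_isPreprimitive_of_isThreeCycle_mem hG hthree hmem

end Cycle

section DegreeSeven

open Equiv Equiv.Perm MulAction

variable {α : Type*} [DecidableEq α] [Fintype α] {G : Subgroup (Perm α)}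

theorem card_support_eq_four_of_orderOf_eq_two (hα : Fintype.card α ≤ 7) {σ : Perm α}
    (hσ : orderOf σ = 2) (hsign : sign σ = 1) : σ.support.card = 4 := by
  obtain ⟨m, hm⟩ := cycleType_prime_order (hσ ▸ Nat.prime_two)
  rw [hσ] at hm
  have hcard : σ.support.card = (m + 1) * 2 := by
    rw [← sum_cycleType, hm, Multiset.sum_replicate, smul_eq_mul]
  have heven : Even ((m + 1) * 2 + (m + 1)) := by
    rw [sign_of_cycleType, hm, Multiset.sum_replicate, Multiset.card_replicate,
      smul_eq_mul] at hsign
    exact (neg_one_pow_eq_one_iff_even (by decide)).mp hsign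
  have := σ.support.card_le_univ
  rw [Nat.even_iff] at heven
  lia

theorem le_card_of_isMultiplyPretransitive_three (hα : Fintype.card α = 7)
    (hG : IsMultiplyPretransitive G α 3) (hGA : G ≤ alternatingGroup α) : 420 ≤ Nat.card G := by
  obtain ⟨e₀⟩ : Nonempty (Fin 3 ↪ α) :=
    Function.Embedding.nonempty_of_card_le (by rw [hα, Fintype.card_fin]; norm_num)
  have htwo : 2 ∣ Nat.card G := by
    rw [← card_stabilizer_mul_descFactorial hG e₀, hα]
    exact Dvd.dvd.mul_left (by decide) _
  obtain ⟨x, hx⟩ := exists_prime_orderOf_dvd_card' 2 htwo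
  have hfix : (x : Perm α).supportᶜ.card = 3 := by
    rw [Finset.card_compl, hα, card_support_eq_four_of_orderOf_eq_two hα.le
      (by rwa [Subgroup.orderOf_coe]) (mem_alternatingGroup.mp (hGA x.2))]
  let e : Fin 3 ↪ α := (Finset.equivFinOfCardEq hfix).symm.toEmbedding.trans
    (Function.Embedding.subtype (· ∈ (x : Perm α).supportᶜ))
  have hxe (i : Fin 3) : x • e i = e i :=
    notMem_support.mp (Finset.mem_compl.mp (Subtype.prop _))
  have hx1 : x ≠ 1 := by
    rintro rfl
    simp at hx
  have hle := two_mul_descFactorial_le_card hG hx1 e hxe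
  rwa [hα] at hle

theorem eq_alternatingGroup_of_isMultiplyPretransitive_three (hα : Fintype.card α = 7)
    (hG : IsMultiplyPretransitive G α 3) (hGA : G ≤ alternatingGroup α) :
    G = alternatingGroup α := by
  have hcardα : Nat.card α = 7 := by rw [Nat.card_eq_fintype_card, hα]
  have : Nontrivial α := Fintype.one_lt_card_iff_nontrivial.mp (by lia)
  have hcard : Nat.card (alternatingGroup α) = 2520 := by
    rw [nat_card_alternatingGroup, hcardα]
    rfl
  have : IsSimpleGroup (alternatingGroup α) := alternatingGroup.isSimpleGroup (by lia)
  have hindex : (G.subgroupOf (alternatingGroup α)).index ≤ 6 := by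
    have hmul := (G.subgroupOf (alternatingGroup α)).card_mul_index
    rw [Nat.card_congr (Subgroup.subgroupOfEquivOfLe hGA).toEquiv, hcard] at hmul
    nlinarith [le_card_of_isMultiplyPretransitive_three hα hG hGA]
  refine le_antisymm hGA (Subgroup.subgroupOf_eq_top.mp (eq_top_of_factorial_index_lt_card ?_))
  calc _ ≤ (6).factorial := Nat.factorial_le hindex
    _ < Nat.card (alternatingGroup α) := by rw [hcard]; decide

theorem alternatingGroup_le_of_isCycle_mem_of_card_eq_seven (hα : Fintype.card α = 7)
    {c d : Perm α} (hc : c.IsCycle) (hcα : c.support.card = 7) (hcG : c ∈ G) (hd : d.IsCycle)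
    (hdα : d.support.card = 5) (hdG : d ∈ G) : alternatingGroup α ≤ G := by
  have hmem {f : Perm α} (hf : f.IsCycle) (hodd : Odd f.support.card) (hfG : f ∈ G) :
      f ∈ G ⊓ alternatingGroup α :=
    ⟨hfG, mem_alternatingGroup.mpr (by rw [hf.sign, hodd.neg_one_pow, neg_neg])⟩
  have hcH := hmem hc (by rw [hcα]; decide) hcG
  have hdH := hmem hd (by rw [hdα]; decide) hdG
  have : IsPretransitive ↥(G ⊓ alternatingGroup α) α :=
    isPretransitive_of_isCycle_mem_of_support_eq_univ hc hcH
      (Finset.card_eq_iff_eq_univ _ |>.mp (hcα.trans hα.symm))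
  have hprim := isPreprimitive_of_isCycle_mem hd (by rw [hdα]; norm_num) hdH (by lia)
  have hmult := isMultiplyPretransitive_of_isCycle_mem hprim hd (by rw [hdα]; norm_num) hdH (by lia)
  rw [hα, hdα] at hmult
  rw [← eq_alternatingGroup_of_isMultiplyPretransitive_three hα hmult inf_le_right]
  exact inf_le_left

end DegreeSeven

theorem eq_alternatingGroup_or_eq_top {α : Type*} [DecidableEq α] [Fintype α]
    {G : Subgroup (Equiv.Perm α)} (h : alternatingGroup α ≤ G) :
    G = alternatingGroup α ∨ G = ⊤ := by
  rcases subsingleton_or_nontrivial α with hα | hα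
  · exact Or.inr (Subsingleton.elim _ _)
  have hmul := Subgroup.relIndex_mul_index h
  rw [alternatingGroup.index_eq_two] at hmul
  rcases Nat.prime_mul_iff.mp (hmul ▸ Nat.prime_two) with ⟨-, hindex⟩ | ⟨-, hrel⟩
  · exact Or.inr (Subgroup.index_eq_one.mp hindex)
  · exact Or.inl (le_antisymm (Subgroup.relIndex_eq_one.mp hrel) h)

theorem IsPartitionTransitive.alternatingGroup_le {n : ℕ} {G : Subgroup (Equiv.Perm (Fin n))}
    {lam : n.Partition} {a : ℕ} {k : List ℕ} (h : IsPartitionTransitive G lam)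
    (hlam : lam.sortedParts = a :: k) (ha : 0 < a) (hk : ∀ b ∈ k, b ≤ a) (h2a : 2 * a ≤ n)
    (h6 : n = 6 → a ≤ 2) : alternatingGroup (Fin n) ≤ G := by
  have hcycle {p : ℕ} (hp : p.Prime) (hap : a < p) (hpn : p ≤ n) :
      ∃ c ∈ G, c.IsCycle ∧ c.support.card = p := by
    refine IsPartitionTransitiveOn.exists_isCycle_mem h (by simp [sum_sortedParts]) hp ?_ (by simpa)
    rw [hlam, List.forall_mem_cons]
    exact ⟨hap, fun b hb => (hk b hb).trans_lt hap⟩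
  have := ((isPartitionTransitive_iff_isStandardAt hlam).mp h).1.isPretransitive (by lia) (by lia)
  have hprim {p : ℕ} (hp : p.Prime) (hpn : p ≤ n) (hnp : n < 2 * p) :
      MulAction.IsPreprimitive G (Fin n) := by
    obtain ⟨c, hcG, hc, rfl⟩ := hcycle hp (by lia) hpn
    exact isPreprimitive_of_isCycle_mem hc hp hcG (by rwa [Fintype.card_fin])
  have hthree (hG : MulAction.IsPreprimitive G (Fin n)) (ha2 : a ≤ 2) (hn : 3 ≤ n) :
      alternatingGroup (Fin n) ≤ G := by
    obtain ⟨c, hcG, -, hc⟩ := hcycle Nat.prime_three (by lia) hn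
    exact Equiv.Perm.alternatingGroup_le_of_isPreprimitive_of_isThreeCycle_mem hG
      (card_support_eq_three_iff.mp hc) hcG
  obtain h8 | rfl | rfl | ⟨h3, h5⟩ | h2 :
      8 ≤ n ∨ n = 7 ∨ n = 6 ∨ (3 ≤ n ∧ n ≤ 5) ∨ n ≤ 2 := by lia
  · obtain ⟨p, hp, hnp, hpn⟩ := exists_prime_lt_two_mul_and_add_three_le h8
    obtain ⟨c, hcG, hc, rfl⟩ := hcycle hp (by lia) (by lia)
    exact alternatingGroup_le_of_isPreprimitive_of_isCycle_mem
      (hprim hp (by lia) hnp) hc hp hcG (by rwa [Fintype.card_fin])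
  · obtain ⟨c, hcG, hc, hc7⟩ := hcycle Nat.prime_seven (by lia) le_rfl
    obtain ⟨d, hdG, hd, hd5⟩ := hcycle Nat.prime_five (by lia) (by lia)
    exact alternatingGroup_le_of_isCycle_mem_of_card_eq_seven (Fintype.card_fin 7)
      hc hc7 hcG hd hd5 hdG
  · exact hthree (hprim Nat.prime_five (by lia) (by lia)) (h6 rfl) (by lia)
  · exact hthree (hprim Nat.prime_three h3 (by lia)) (by lia) h3
  · rw [alternatingGroup.eq_bot_of_card_le_two (by rwa [Nat.card_fin])]
    exact bot_le

theorem theorem1p2 (n : ℕ) (lam : n.Partition) (hlam : lam ≠ Nat.Partition.indiscrete n)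
    (G : Subgroup (Equiv.Perm (Fin n)))
    (hA : G ≠ alternatingGroup (Fin n)) (hS : G ≠ ⊤) :
    (IsPartitionTransitive G lam ↔ IsStandard G lam) ∧
      (n ≠ 6 → (IsPartitionTransitive G lam ↔ IsStrictlyStandard G lam)) := by
  have hn : n ≠ 0 := by
    rintro rfl
    exact hlam (Subsingleton.elim _ _)
  obtain ⟨a, k, hak, ha, hk⟩ := exists_sortedParts_eq_cons hn lam
  have hbound (h : IsPartitionTransitive G lam) (h2a : 2 * a ≤ n) : n = 6 ∧ 2 < a := by
    by_contra hcon
    exact (eq_alternatingGroup_or_eq_top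
      (h.alternatingGroup_le hak ha hk h2a (by lia))).elim hA hS
  have hstd := isPartitionTransitive_iff_isStandardAt (G := G) hak
  refine ⟨⟨fun h => ⟨n - a, ?_, hstd.mp h⟩, fun ⟨t, ht, h⟩ => h.isPartitionTransitive (by lia)⟩,
    fun h6 => ⟨fun h => ⟨n - a, ?_, hstd.mp h⟩, fun ⟨t, ht, h⟩ => h.isPartitionTransitive (by lia)⟩⟩
  · by_contra! hlt
    have := hbound h (by lia)
    lia
  · by_contra! hlt
    exact h6 (hbound h (by lia)).1
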